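/- **Theorem (sparse case convergence).** Let $N,M\ge 0$ be integers and let agents $i\in\mathcal I=\{1,\dots,N\}$ communicate over an undirected graph $\mathcal G=(\mathcal I,E)$. For each $i$ let $f_i:\mathbb R^{d_i}\to\mathbb R$ be convex, and let $a_i^m\in\mathbb R^{d_i}$, $b_i^m\in\mathbb R$ for $m\in\mathcal M=\{1,\dots,M\}$. Consider the centralized problem $$\min_{x=(x_1,\dots,x_N)}\ \sum_{i} f_i(x_i)\quad\text{s.t.}\quad \sum_{i}\bigl(a_i^{m\top}x_i+b_i^m\bigr)\le 0\ \ (m\in\mathcal M),\tag{P}$$ and assume that its optimal value is finite and attained. Let $\mathcal I_m=\{i: a_i^m\ne 0\text{ or } b_i^m\neq 0\}$, $\mathcal M_i=\{m: i\in\mathcal I_m\}$, $N_i^m=\{j\in\mathcal I_m:(i,j)\in E\}$, and assume that for each $m$ any two agents in $\mathcal I_m$ are joined by a path of $\mathcal G$ that stays in $\mathcal I_m$. For $y=(y_i^m)\in\mathbb R^{NM}$ the local problem of agent $i$ is $$\phi_i(y)=\inf_{x_i} f_i(x_i)\quad\text{s.t.}\quad a_i^{m\top}x_i+\sum_{j\in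 N_i^m}(y_i^m-y_j^m)+b_i^m\le 0\ \ (m\in\mathcal M_i).\tag{P_i(y)}$$ Assume that for all $y$ and $i$ some $x_i$ satisfies all constraints of $(P_i(y))$ strictly. Put $\phi=\sum_i\phi_i$. The equivalent problem is to minimize $\sum_i f_i(x_i)$ over all pairs $(x,y)$ such that each $x_i$ is feasible for $(P_i(y))$. For every $y$ and $i$ let $c_i(y)=(c_i^1,\dots,c_i^M)$ consist of a Lagrange multiplier of $(P_i(y))$ for $m\in\mathcal M_i$ (nonnegative numbers for which the infimum of the Lagrangian over $x_i$ equals $\phi_i(y)$) and zeros for $m\notin\mathcal M_i$. Let $k_0>0$ and let $y:[0,\infty)\to\mathbb R^{NM}$ be a Carathéodory solution (absolutely continuous on compact intervals, the equation holding for almost all $t$) of $$\dot y_i^m=-k_0\sum_{j\in N_i^m}\bigl(c_i^m(y)-c_j^m(y)\bigr)\ \text{ if } m\in\mathcal M_i,\qquad \dot y_i^m=0\ \text{ if } m\notin\mathcal M_i .$$ Then: 1. The Carathéodory solution with initial value $y(0)$ is unique, and $y(t)$ converges, as $t\to\infty$, to the nonempty set $\{\eta:\phi(\eta)=\min\phi\}$.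 If the minimum in $(P_i(\eta))$ is attained for all $\eta$ and $i$, then $y(t)$ converges to the set of those $\eta$ for which $(x,\eta)$ is optimal for the equivalent problem for some $x$. (Convergence to a set means that the distance to it tends to $0$.) 2. Let $x_i(t)$ be an optimal solution of $(P_i(y(t)))$ for all $i$ and $t\ge0$. Then $\sum_i f_i(x_i(t))$ converges to the optimal value of (P), and every cluster point of $x(t)$ as $t\to\infty$ is an optimal solution of (P). If the set of optimal solutions of (P) is bounded, or if $x(\cdot)$ is bounded on some $[T,\infty)$, then $x(t)$ converges to the set of optimal solutions of (P). If $(P_i(\eta))$ has exactly one optimal solution for all $\eta$ and $i$, then $x(t)$ converges to an optimal solution of (P). 3. For all $t\ge 0$, if each $x_i$ is feasible for $(P_i(y(t)))$ (in particular if each $x_i$ is an optimal solution of it), then $x=(x_1,\dots,x_N)$ satisfies the coupling constraints of (P). -/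

import Mathlib

open Filter Topology MeasureTheory

/-- Data of a separable program with `M` linear coupling constraints over a network of `N` agents:
agent `i` has a decision vector in `ℝ^(d i)`, a cost, coefficients `a i m` and `b i m` in the
`m`-th constraint, and communicates along the edges of the undirected graph `graph`. -/
structure CoupledProgram (N M : ℕ) where
  d : Fin N → ℕ
  cost : (i : Fin N) → EuclideanSpace ℝ (Fin (d i)) → ℝ
  a : (i : Fin N) → Fin M → EuclideanSpace ℝ (Fin (d i))
  b : Fin N → Fin M → ℝ
  graph : SimpleGraph (Fin N)

namespace CoupledProgram

variable {N M : ℕ}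

/-- Local decision vectors of agent `i`. -/
abbrev Local (P : CoupledProgram N M) (i : Fin N) : Type := EuclideanSpace ℝ (Fin (P.d i))

/-- Stacked primal decision vectors. -/
abbrev Primal (P : CoupledProgram N M) : Type := (i : Fin N) → P.Local i

/-- Stacked auxiliary variables; `y (i, m)` is the variable of agent `i` for constraint `m`. -/
abbrev Aux (N M : ℕ) : Type := EuclideanSpace ℝ (Fin N × Fin M)

/-- The separable objective. -/
noncomputable def totalCost (P : CoupledProgram N M) (x : P.Primal) : ℝ := ∑ i, P.cost i (x i)

/-- Feasibility for the centralized (coupled) problem. -/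
def Feasible (P : CoupledProgram N M) (x : P.Primal) : Prop :=
  ∀ m, ∑ i, (inner ℝ (P.a i m) (x i) + P.b i m) ≤ 0

/-- Optimal solutions of the centralized problem. -/
def IsOptimal (P : CoupledProgram N M) (x : P.Primal) : Prop :=
  P.Feasible x ∧ ∀ x', P.Feasible x' → P.totalCost x ≤ P.totalCost x'

/-- Agent `i` is involved in constraint `m`. -/
def Involved (P : CoupledProgram N M) (i : Fin N) (m : Fin M) : Prop :=
  P.a i m ≠ 0 ∨ P.b i m ≠ 0

/-- The graph is consistent with the `m`-th constraint: any two agents involved in it are joined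
by a path through agents involved in it. -/
def Consistent (P : CoupledProgram N M) (m : Fin M) : Prop :=
  (P.graph.induce {i | P.Involved i m}).Preconnected

open Classical in
/-- The neighbours of agent `i` that are involved in constraint `m`. -/
noncomputable def nbrs (P : CoupledProgram N M) (i : Fin N) (m : Fin M) : Finset (Fin N) :=
  Finset.univ.filter fun j => P.graph.Adj i j ∧ P.Involved j m

/-- Left-hand side of the `m`-th local constraint of agent `i`, for given auxiliary variables. -/
noncomputable def localConstraint (P : CoupledProgram N M) (y : Aux N M) (i : Fin N) (m : Fin M)
    (xi : P.Local i) : ℝ :=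
  inner ℝ (P.a i m) xi + ∑ j ∈ P.nbrs i m, (y (i, m) - y (j, m)) + P.b i m

/-- Feasibility for the local problem of agent `i` (only constraints involving `i` occur). -/
def LocalFeasible (P : CoupledProgram N M) (y : Aux N M) (i : Fin N) (xi : P.Local i) : Prop :=
  ∀ m, P.Involved i m → P.localConstraint y i m xi ≤ 0

/-- Optimal solutions of the local problem of agent `i`. -/
def IsLocalSolution (P : CoupledProgram N M) (y : Aux N M) (i : Fin N) (xi : P.Local i) : Prop :=
  P.LocalFeasible y i xi ∧ ∀ x', P.LocalFeasible y i x' → P.cost i xi ≤ P.cost i x'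

/-- Slater's condition for all local problems and all auxiliary variables. -/
def LocalSlater (P : CoupledProgram N M) : Prop :=
  ∀ (y : Aux N M) (i : Fin N),
    ∃ xi : P.Local i, ∀ m, P.Involved i m → P.localConstraint y i m xi < 0

/-- Optimal value `φ_i(y)` of the local problem of agent `i`. -/
noncomputable def localValue (P : CoupledProgram N M) (y : Aux N M) (i : Fin N) : ℝ :=
  sInf (P.cost i '' {xi | P.LocalFeasible y i xi})

/-- `φ(y) = ∑ i, φ_i(y)`. -/
noncomputable def value (P : CoupledProgram N M) (y : Aux N M) : ℝ := ∑ i, P.localValue y i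

/-- Optimal pairs of the equivalent problem, in which the auxiliary variables are decision
variables too. -/
def IsEquivOptimal (P : CoupledProgram N M) (x : P.Primal) (y : Aux N M) : Prop :=
  (∀ i, P.LocalFeasible y i (x i)) ∧
    ∀ x' y', (∀ i, P.LocalFeasible y' i (x' i)) → P.totalCost x ≤ P.totalCost x'

/-- `ci` is a Lagrange multiplier of the local problem of agent `i`, extended by zero to the
constraints that do not involve `i`: it is nonnegative and the infimum of the Lagrangian is the
optimal value of the problem. -/
def IsLagrangeMultiplier (P : CoupledProgram N M) (y : Aux N M) (i : Fin N)
    (ci : Fin M → ℝ) : Prop :=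
  (∀ m, 0 ≤ ci m) ∧ (∀ m, ¬ P.Involved i m → ci m = 0) ∧
    IsGLB (Set.range fun xi : P.Local i => P.cost i xi + ∑ m, ci m * P.localConstraint y i m xi)
      (P.localValue y i)

open Classical in
/-- Right-hand side of the sparse update law, for a selection `c` of multipliers (`c y i` is the
multiplier vector used by agent `i` at `y`). -/
noncomputable def updateField (P : CoupledProgram N M) (k₀ : ℝ)
    (c : Aux N M → Fin N → Fin M → ℝ) (y : Aux N M) : Aux N M :=
  WithLp.toLp 2 fun p => if P.Involved p.1 p.2 then
    -k₀ * ∑ j ∈ P.nbrs p.1 p.2, (c y p.1 p.2 - c y j p.2) else 0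

end CoupledProgram

/-- Carathéodory solutions on `[0, ∞)` of `u' = F(u)`: absolutely continuous on every compact
interval and satisfying the equation almost everywhere. -/
def IsCaratheodorySolution {E : Type*} [NormedAddCommGroup E] [NormedSpace ℝ E]
    (F : E → E) (u : ℝ → E) : Prop :=
  (∀ T : ℝ, 0 ≤ T → AbsolutelyContinuousOnInterval u 0 T) ∧
    ∀ᵐ t ∂(volume.restrict (Set.Ici (0 : ℝ))), HasDerivAt u (F (u t)) t

/-- Convergence of a trajectory to a set as `t → ∞`; in particular the set is nonempty. -/
def ConvergesToSet {E : Type*} [PseudoMetricSpace E] (u : ℝ → E) (S : Set E) : Prop :=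
  ∀ ε > 0, ∀ᶠ t in atTop, ∃ z ∈ S, dist (u t) z < ε

/-!
The update law is a subgradient flow. By weak duality, multipliers `c` of the local problems at `y`
give a subgradient `g` of the convex function `value` at `y`, whose `(i, m)` entry is
`∑ j ∈ nbrs i m, (c i m - c j m)` (`value_add_inner_le`); hence `updateField = -k₀ • g`.

Subgradients are monotone, so the distance of two solutions does not increase and solutions are
unique (`subgradientFlow_unique`). For a minimizer `z`, the squared distance `‖y - z‖²` decreases at
least at the rate `2 k₀ (value y - value z)`, so it is nonincreasing and `value y` comes arbitrarily
close to the minimum. A subsequence therefore converges to some minimizer `η`, and since `‖y - η‖` is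
nonincreasing the whole solution converges to `η` (`subgradientFlow_tendsto`).

A minimizer of `value` exists, and the minimum is the optimal value of the coupled problem. Locally
feasible points satisfy the coupling constraints because the auxiliary terms cancel
(`feasible_of_localFeasible`). Conversely, on the connected graph of the agents involved in a
constraint the Laplacian is onto the functions with sum zero, which yields auxiliary variables for
any point that satisfies the coupling constraints (`exists_localFeasible`).

For the primal variables, `programMerit` adds the positive parts of the suboptimality and of the
constraint functions. It is convex, continuous and nonnegative, vanishes exactly at the solutions, and
tends to zero along the local solutions. Cluster points are therefore solutions, and a bounded
solution set forces boundedness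
(`ConvexOn.eventually_mem_closedBall_of_isBounded_zeros`). If the local solutions are unique, the same
argument for each local problem at the limit `η` shows that the local solutions converge
(`tendsto_localSolution`).
-/

/-! ### Absolutely continuous functions -/

theorem AbsolutelyContinuousOnInterval.norm_sq {E : Type*} [NormedAddCommGroup E]
    {f : ℝ → E} {a b : ℝ} (hf : AbsolutelyContinuousOnInterval f a b) :
    AbsolutelyContinuousOnInterval (fun t => ‖f t‖ ^ 2) a b := by
  have h : AbsolutelyContinuousOnInterval (fun t => ‖f t‖) a b := by
    refine squeeze_zero (fun E => Finset.sum_nonneg fun i _ => dist_nonneg)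
      (fun E => Finset.sum_le_sum fun i _ => ?_) hf
    rw [Real.dist_eq, dist_eq_norm]
    exact abs_norm_sub_norm_le _ _
  simpa only [pow_two] using h.fun_mul h

/-- A function that is absolutely continuous on compact intervals and whose derivative is at most
`C` almost everywhere grows at most at rate `C`. -/
theorem AbsolutelyContinuousOnInterval.sub_le_of_ae_deriv_le {f : ℝ → ℝ} {a b C : ℝ}
    (hab : a ≤ b) (hf : AbsolutelyContinuousOnInterval f a b)
    (h : ∀ᵐ t ∂volume.restrict (Set.Icc a b), deriv f t ≤ C) :
    f b - f a ≤ C * (b - a) := by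
  rw [← hf.integral_deriv_eq_sub]
  have := intervalIntegral.integral_mono_ae_restrict hab hf.intervalIntegrable_deriv
    (intervalIntegrable_const (c := C)) h
  simpa [mul_comm] using this

/-! ### Flows of subgradients of convex functions -/

section SubgradientFlow

variable {E : Type*} [NormedAddCommGroup E] [InnerProductSpace ℝ E]
  {φ : E → ℝ} {g : E → E} {k : ℝ} {u v : ℝ → E}

local notation "⟪" x ", " y "⟫" => inner ℝ x y

theorem convexOn_of_subgradient (hg : ∀ y z, φ y + ⟪g y, z - y⟫ ≤ φ z) :
    ConvexOn ℝ Set.univ φ := by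
  refine ⟨convex_univ, fun x _ y _ a b ha hb hab => ?_⟩
  have hx := mul_le_mul_of_nonneg_left (hg (a • x + b • y) x) ha
  have hy := mul_le_mul_of_nonneg_left (hg (a • x + b • y) y) hb
  have h0 : a * ⟪g (a • x + b • y), x - (a • x + b • y)⟫
      + b * ⟪g (a • x + b • y), y - (a • x + b • y)⟫ = 0 := by
    rw [← real_inner_smul_right, ← real_inner_smul_right, ← inner_add_right]
    have : a • (x - (a • x + b • y)) + b • (y - (a • x + b • y)) = 0 := by
      obtain rfl : b = 1 - a := by linarith
      module
    rw [this, inner_zero_right]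
  have h1 : φ (a • x + b • y) = a * φ (a • x + b • y) + b * φ (a • x + b • y) := by
    rw [← add_mul, hab, one_mul]
  simp only [smul_eq_mul]
  linarith

/-- The squared distance of a subgradient flow to a fixed point `z` decreases at least at the
rate `2 k (φ (u t) - φ z)`, stated for a lower bound `δ` of `φ (u t) - φ z`. -/
theorem subgradientFlow_norm_sub_sq_le (hk : 0 < k) (hg : ∀ y z, φ y + ⟪g y, z - y⟫ ≤ φ z)
    (hu : IsCaratheodorySolution (fun y => -k • g y) u) {z : E} {δ a b : ℝ}
    (ha : 0 ≤ a) (hab : a ≤ b) (hδ : ∀ t, a ≤ t → φ z + δ ≤ φ (u t)) :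
    ‖u b - z‖ ^ 2 - ‖u a - z‖ ^ 2 ≤ -(2 * k * δ) * (b - a) := by
  have hac : AbsolutelyContinuousOnInterval (fun t => u t - z) a b := by
    refine ((hu.1 b (ha.trans hab)).mono ?_).fun_sub ?_
    · rw [Set.uIcc_of_le hab, Set.uIcc_of_le (ha.trans hab)]
      exact Set.Icc_subset_Icc_left ha
    · simpa [AbsolutelyContinuousOnInterval] using tendsto_const_nhds
  refine hac.norm_sq.sub_le_of_ae_deriv_le hab ?_
  have h2 : ∀ᵐ t ∂volume.restrict (Set.Icc a b), HasDerivAt u (-k • g (u t)) t :=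
    ae_restrict_of_ae_restrict_of_subset (fun t ht => ha.trans ht.1) hu.2
  filter_upwards [h2, ae_restrict_mem measurableSet_Icc] with t ht htm
  have hd := (ht.sub_const z).norm_sq
  rw [hd.deriv]
  have h3 := hg (u t) z
  have h4 := hδ t htm.1
  have h5 : ⟪u t - z, -k • g (u t)⟫ = k * ⟪g (u t), z - u t⟫ := by
    rw [inner_smul_right, real_inner_comm, ← neg_sub z, inner_neg_right]; ring
  rw [h5]
  nlinarith [mul_le_mul_of_nonneg_left (show ⟪g (u t), z - u t⟫ ≤ -δ by linarith) hk.le]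

/-- The distance to a minimizer does not increase along a subgradient flow. -/
theorem subgradientFlow_norm_sub_le (hk : 0 < k) (hg : ∀ y z, φ y + ⟪g y, z - y⟫ ≤ φ z)
    (hu : IsCaratheodorySolution (fun y => -k • g y) u) {z : E} (hz : ∀ y, φ z ≤ φ y)
    {a b : ℝ} (ha : 0 ≤ a) (hab : a ≤ b) : ‖u b - z‖ ≤ ‖u a - z‖ := by
  have := subgradientFlow_norm_sub_sq_le (δ := 0) hk hg hu ha hab (z := z)
    (fun t _ => by simpa using hz (u t))
  refine (sq_le_sq₀ (norm_nonneg _) (norm_nonneg _)).1 ?_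
  linarith

/-- Subgradients are monotone, so two flows do not move apart. -/
theorem subgradientFlow_unique (hk : 0 < k) (hg : ∀ y z, φ y + ⟪g y, z - y⟫ ≤ φ z)
    (hu : IsCaratheodorySolution (fun y => -k • g y) u)
    (hv : IsCaratheodorySolution (fun y => -k • g y) v) (h0 : v 0 = u 0) {t : ℝ} (ht : 0 ≤ t) :
    v t = u t := by
  have hac : AbsolutelyContinuousOnInterval (fun s => v s - u s) 0 t :=
    (hv.1 t ht).fun_sub (hu.1 t ht)
  have h := hac.norm_sq.sub_le_of_ae_deriv_le (C := 0) ht ?_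
  · rw [h0, sub_self, norm_zero] at h
    have h1 : ‖v t - u t‖ ^ 2 = 0 := le_antisymm (by linarith) (sq_nonneg _)
    simpa [sub_eq_zero] using h1
  · have hsub : Set.Icc 0 t ⊆ Set.Ici 0 := fun s hs => hs.1
    filter_upwards [ae_restrict_of_ae_restrict_of_subset hsub hu.2,
      ae_restrict_of_ae_restrict_of_subset hsub hv.2] with s hus hvs
    rw [(hvs.fun_sub hus).norm_sq.deriv]
    have h1 := hg (u s) (v s)
    have h2 := hg (v s) (u s)
    have h3 : ⟪v s - u s, -k • g (v s) - -k • g (u s)⟫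
        = k * (⟪g (v s), u s - v s⟫ + ⟪g (u s), v s - u s⟫) := by
      rw [← smul_sub, inner_smul_right, real_inner_comm, ← neg_sub (v s) (u s), inner_neg_right,
        inner_sub_left]
      ring
    rw [h3]
    nlinarith [mul_nonneg hk.le (show 0 ≤
      -(⟪g (v s), u s - v s⟫ + ⟪g (u s), v s - u s⟫) by linarith)]

/-- The values along a subgradient flow come arbitrarily close to the minimum: otherwise the
squared distance to a minimizer would decrease to `-∞`. -/
theorem subgradientFlow_frequently_lt (hk : 0 < k) (hg : ∀ y z, φ y + ⟪g y, z - y⟫ ≤ φ z)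
    (hu : IsCaratheodorySolution (fun y => -k • g y) u) (z : E) {ε : ℝ} (hε : 0 < ε) :
    ∃ᶠ t in atTop, φ (u t) < φ z + ε := by
  intro hcon
  obtain ⟨a, ha⟩ := eventually_atTop.1 (hcon.and (eventually_ge_atTop (0 : ℝ)))
  have ha0 : 0 ≤ a := (ha a le_rfl).2
  have hlow : ∀ t, a ≤ t → φ z + ε ≤ φ (u t) := fun t ht => not_lt.1 (ha t ht).1
  have hpos : 0 < 2 * k * ε := by positivity
  set s : ℝ := (‖u a - z‖ ^ 2 + 1) / (2 * k * ε) with hs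
  have hs0 : 0 ≤ s := by positivity
  have h := subgradientFlow_norm_sub_sq_le hk hg hu ha0 (le_add_of_nonneg_right hs0) hlow
  have h1 : 2 * k * ε * s = ‖u a - z‖ ^ 2 + 1 := by rw [hs]; field_simp
  have h2 : -(2 * k * ε) * (a + s - a) = -(‖u a - z‖ ^ 2 + 1) := by rw [← h1]; ring
  rw [h2] at h
  nlinarith [sq_nonneg ‖u (a + s) - z‖]

/-- A subgradient flow of a convex function that has a minimizer converges to a minimizer: a
subsequence with values tending to the minimum clusters at some minimizer `η`, and the distance of
the flow to `η` does not increase. -/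
theorem subgradientFlow_tendsto [FiniteDimensional ℝ E] (hk : 0 < k)
    (hg : ∀ y z, φ y + ⟪g y, z - y⟫ ≤ φ z)
    (hu : IsCaratheodorySolution (fun y => -k • g y) u) {z : E} (hz : ∀ y, φ z ≤ φ y) :
    ∃ η, (∀ y, φ η ≤ φ y) ∧ Tendsto u atTop (𝓝 η) := by
  have hcont : Continuous φ := (convexOn_of_subgradient hg).locallyLipschitz.continuous
  have hfreq : ∀ n : ℕ, ∃ t : ℝ, (n : ℝ) ≤ t ∧ φ (u t) < φ z + 1 / ((n : ℝ) + 1) := fun n => by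
    obtain ⟨t, ht, h⟩ := frequently_atTop.1
      (subgradientFlow_frequently_lt hk hg hu z (ε := 1 / ((n : ℝ) + 1)) (by positivity)) n
    exact ⟨t, ht, h⟩
  choose τ hτ hφτ using hfreq
  have hτ0 : ∀ n, 0 ≤ τ n := fun n => (Nat.cast_nonneg n).trans (hτ n)
  obtain ⟨η, -, ψ, hψ, hlim⟩ := (isCompact_closedBall z ‖u 0 - z‖).tendsto_subseq
    (x := fun n => u (τ n)) (fun n => by
      rw [mem_closedBall_iff_norm]
      exact subgradientFlow_norm_sub_le hk hg hu hz le_rfl (hτ0 n))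
  have hη : φ η ≤ φ z := by
    have h1 : Tendsto (fun n => φ (u (τ (ψ n)))) atTop (𝓝 (φ η)) := (hcont.tendsto η).comp hlim
    have h2 : Tendsto (fun n => φ z + 1 / ((ψ n : ℝ) + 1)) atTop (𝓝 (φ z + 0)) :=
      tendsto_const_nhds.add (tendsto_one_div_add_atTop_nhds_zero_nat.comp hψ.tendsto_atTop)
    rw [add_zero] at h2
    exact le_of_tendsto_of_tendsto' h1 h2 fun n => (hφτ (ψ n)).le
  have hηmin : ∀ y, φ η ≤ φ y := fun y => hη.trans (hz y)
  refine ⟨η, hηmin, Metric.tendsto_atTop.2 fun ε hε => ?_⟩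
  obtain ⟨n, hn⟩ := (Metric.tendsto_nhds.1 hlim ε hε).exists
  refine ⟨τ (ψ n), fun t ht => ?_⟩
  simp only [Function.comp_apply, dist_eq_norm] at hn ⊢
  exact (subgradientFlow_norm_sub_le hk hg hu hηmin (hτ0 _) ht).trans_lt hn

end SubgradientFlow

/-! ### Asymptotically optimal points of convex programs -/

theorem ConvexOn.finset_sum {E ι : Type*} [AddCommGroup E] [Module ℝ E] (s : Finset ι)
    {f : ι → E → ℝ} (hf : ∀ i ∈ s, ConvexOn ℝ Set.univ (f i)) :
    ConvexOn ℝ Set.univ fun x => ∑ i ∈ s, f i x := by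
  classical
  induction s using Finset.induction_on with
  | empty => simpa using convexOn_const 0 convex_univ
  | insert i s hi ih =>
    simp only [Finset.sum_insert hi]
    exact (hf i (by simp)).add (ih fun j hj => hf j (by simp [hj]))

theorem MapClusterPt.eq_of_tendsto_comp {α X Y : Type*} [TopologicalSpace X] [TopologicalSpace Y]
    [T2Space Y] {V : X → Y} (hV : Continuous V) {F : Filter α} {x : α → X} {z : X}
    (hz : MapClusterPt z F x) {v : Y} (hx : Tendsto (fun t => V (x t)) F (𝓝 v)) : V z = v := by
  obtain ⟨U, hU, h⟩ := mapClusterPt_iff_ultrafilter.1 hz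
  exact tendsto_nhds_unique ((hV.tendsto z).comp h) (hx.mono_left hU)

/-- If `x` stays in a compact set and a continuous function tends to `0` along `x`, then `x`
converges to the zero set of the function. -/
theorem convergesToSet_zeros_of_isCompact {E : Type*} [PseudoMetricSpace E] {V : E → ℝ}
    (hV : Continuous V) {x : ℝ → E} (hx : Tendsto (fun t => V (x t)) atTop (𝓝 0)) {K : Set E}
    (hK : IsCompact K) (hxK : ∀ᶠ t in atTop, x t ∈ K) : ConvergesToSet x {z | V z = 0} := by
  intro ε hε
  by_contra hcon
  have hA : IsCompact (K ∩ {p | ∀ z, V z = 0 → ε ≤ dist p z}) := by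
    refine hK.inter_right ?_
    simp only [Set.ofPred_forall]
    exact isClosed_iInter fun z => isClosed_iInter fun _ =>
      isClosed_le continuous_const (continuous_id.dist continuous_const)
  have hfr : ∃ᶠ t in atTop, x t ∈ K ∩ {p | ∀ z, V z = 0 → ε ≤ dist p z} := by
    refine ((not_eventually.1 hcon).and_eventually hxK).mono fun t ht => ⟨ht.2, fun z hz => ?_⟩
    by_contra h
    exact ht.1 ⟨z, hz, not_le.1 h⟩
  obtain ⟨z, hz, hcl⟩ := hA.exists_mapClusterPt_of_frequently hfr
  have := hz.2 z (hcl.eq_of_tendsto_comp hV hx)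
  rw [dist_self] at this
  exact absurd this (not_le.2 hε)

/-- If the zero set of a nonnegative convex function is nonempty and bounded, points at which the
function is small are bounded too: around a zero `z₀` draw a sphere that encloses the zero set; by
convexity, the function is at least its positive minimum over the sphere outside of it. -/
theorem ConvexOn.eventually_mem_closedBall_of_isBounded_zeros {E : Type*} [NormedAddCommGroup E]
    [NormedSpace ℝ E] [FiniteDimensional ℝ E] {V : E → ℝ} (hV : ConvexOn ℝ Set.univ V)
    (hV0 : ∀ z, 0 ≤ V z) {z₀ : E} (hz₀ : V z₀ = 0) (hb : Bornology.IsBounded {z | V z = 0})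
    {x : ℝ → E} (hx : Tendsto (fun t => V (x t)) atTop (𝓝 0)) :
    ∃ R, ∀ᶠ t in atTop, x t ∈ Metric.closedBall z₀ R := by
  have hc : Continuous V := hV.locallyLipschitz.continuous
  have : ProperSpace E := FiniteDimensional.proper ℝ E
  obtain ⟨R, hR, hsub⟩ := hb.subset_ball_lt 0 z₀
  obtain ⟨ρ, hρ, hmin⟩ := (isCompact_sphere z₀ R).exists_forall_le' hc.continuousOn (a := 0)
    fun z hz => lt_of_le_of_ne (hV0 z) fun h => by
      have h1 : z ∈ Metric.ball z₀ R := hsub h.symm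
      rw [Metric.mem_ball, Metric.mem_sphere.1 hz] at h1
      exact lt_irrefl _ h1
  refine ⟨R, ?_⟩
  filter_upwards [hx.eventually (gt_mem_nhds hρ)] with t ht
  rw [Metric.mem_closedBall, dist_eq_norm]
  by_contra! hlt
  have hn : 0 < ‖x t - z₀‖ := hR.trans hlt
  set a : ℝ := R / ‖x t - z₀‖ with ha
  have ha0 : 0 ≤ a := by positivity
  have ha1 : a ≤ 1 := (div_le_one hn).2 hlt.le
  have hw := hmin ((1 - a) • z₀ + a • x t) (by
    have h1 : (1 - a) • z₀ + a • x t - z₀ = a • (x t - z₀) := by module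
    rw [Metric.mem_sphere, dist_eq_norm, h1, norm_smul, Real.norm_of_nonneg ha0, ha,
      div_mul_cancel₀ _ hn.ne'])
  have hconv := hV.2 (Set.mem_univ z₀) (Set.mem_univ (x t)) (sub_nonneg.2 ha1) ha0
    (sub_add_cancel 1 a)
  rw [hz₀, smul_zero, zero_add, smul_eq_mul] at hconv
  nlinarith [hV0 (x t)]

/-- A measure of how far `x` is from solving the program `min f` subject to `h m ≤ 0` with optimal
value `v`: the positive parts of the suboptimality and of the constraint functions are added. -/
noncomputable def programMerit {E ι : Type*} [Fintype ι] (f : E → ℝ) (h : ι → E → ℝ) (v : ℝ)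
    (x : E) : ℝ := max (f x - v) 0 + ∑ m, max (h m x) 0

section ProgramMerit

variable {E ι : Type*} [Fintype ι] {f : E → ℝ} {h : ι → E → ℝ} {v : ℝ}

theorem programMerit_nonneg (x : E) : 0 ≤ programMerit f h v x :=
  add_nonneg (le_max_right _ _) (Finset.sum_nonneg fun _ _ => le_max_right _ _)

theorem programMerit_eq_zero_iff {x : E} :
    programMerit f h v x = 0 ↔ f x ≤ v ∧ ∀ m, h m x ≤ 0 := by
  rw [programMerit, add_eq_zero_iff_of_nonneg (le_max_right _ _)
    (Finset.sum_nonneg fun _ _ => le_max_right _ _), max_eq_right_iff, sub_nonpos,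
    Finset.sum_eq_zero_iff_of_nonneg fun _ _ => le_max_right _ _]
  simp

theorem convexOn_programMerit [AddCommGroup E] [Module ℝ E] (hf : ConvexOn ℝ Set.univ f)
    (hh : ∀ m, ConvexOn ℝ Set.univ (h m)) : ConvexOn ℝ Set.univ (programMerit f h v) := by
  have h0 : ConvexOn ℝ (Set.univ : Set E) fun _ => (0 : ℝ) := convexOn_const 0 convex_univ
  have h1 : ConvexOn ℝ Set.univ fun x => f x - v := by
    simp only [sub_eq_add_neg]
    exact ConvexOn.add_const hf (-v)
  exact (h1.sup h0).add (ConvexOn.finset_sum _ fun m _ => (hh m).sup h0)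

theorem tendsto_programMerit {x : ℝ → E} {w : ι → ℝ → ℝ}
    (hf : Tendsto (fun t => f (x t)) atTop (𝓝 v)) (hw : ∀ m, Tendsto (w m) atTop (𝓝 0))
    (hh : ∀ m, ∀ᶠ t in atTop, h m (x t) ≤ w m t) :
    Tendsto (fun t => programMerit f h v (x t)) atTop (𝓝 0) := by
  have h1 : Tendsto (fun t => max (f (x t) - v) 0) atTop (𝓝 0) := by
    simpa using (hf.sub_const v).max (tendsto_const_nhds (x := (0 : ℝ)))
  have h2 : ∀ m, Tendsto (fun t => max (h m (x t)) 0) atTop (𝓝 0) := fun m => by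
    have h3 : Tendsto (fun t => max (w m t) 0) atTop (𝓝 0) := by
      simpa using (hw m).max (tendsto_const_nhds (x := (0 : ℝ)))
    refine tendsto_of_tendsto_of_tendsto_of_le_of_le' tendsto_const_nhds h3
      (Eventually.of_forall fun t => le_max_right _ _) ?_
    filter_upwards [hh m] with t ht
    exact max_le_max_right 0 ht
  simpa [programMerit] using h1.add (tendsto_finsetSum Finset.univ fun m _ => h2 m)

end ProgramMerit

/-! ### Laplace equations on graphs -/

/-- On a connected graph the Laplacian is onto the functions with sum zero: it is symmetric and its
kernel consists of the constant functions. -/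
theorem SimpleGraph.Preconnected.exists_lapMatrix_mulVec_eq {V : Type*} [Fintype V] [DecidableEq V]
    {G : SimpleGraph V} [DecidableRel G.Adj] (hG : G.Preconnected) {r : V → ℝ}
    (hr : ∑ i, r i = 0) : ∃ u : V → ℝ, (G.lapMatrix ℝ).mulVec u = r := by
  have hsym : (Matrix.toEuclideanLin (G.lapMatrix ℝ)).IsSymmetric :=
    Matrix.isSymmetric_toEuclideanLin_iff.2 (G.isHermitian_lapMatrix ℝ)
  have hmem : WithLp.toLp 2 r ∈ LinearMap.range (Matrix.toEuclideanLin (G.lapMatrix ℝ)) := by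
    rw [← Submodule.orthogonal_orthogonal (LinearMap.range _), hsym.orthogonal_range,
      Submodule.mem_orthogonal]
    intro w hw
    have hw' : (G.lapMatrix ℝ).mulVec w.ofLp = 0 := congrArg WithLp.ofLp hw
    rw [G.lapMatrix_mulVec_eq_zero_iff_forall_reachable] at hw'
    rcases isEmpty_or_nonempty V with hV | ⟨⟨i₀⟩⟩
    · simp [PiLp.inner_apply]
    · simp [PiLp.inner_apply, fun i => hw' i i₀ (hG i i₀), ← Finset.sum_mul, hr]
  obtain ⟨u, hu⟩ := hmem
  exact ⟨u.ofLp, congrArg WithLp.ofLp hu⟩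

/-! ### The local problems -/

namespace CoupledProgram

variable {N M : ℕ} {P : CoupledProgram N M}

theorem mem_nbrs {i j : Fin N} {m : Fin M} :
    j ∈ P.nbrs i m ↔ P.graph.Adj i j ∧ P.Involved j m := by
  simp [nbrs]

open Classical in
/-- Sums over the pairs of adjacent agents that are both involved in a constraint are symmetric. -/
theorem sum_nbrs_comm (m : Fin M) (F : Fin N → Fin N → ℝ) :
    ∑ i, (if P.Involved i m then ∑ j ∈ P.nbrs i m, F i j else 0) =
      ∑ i, (if P.Involved i m then ∑ j ∈ P.nbrs i m, F j i else 0) := by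
  have key : ∀ G : Fin N → Fin N → ℝ,
      ∑ i, (if P.Involved i m then ∑ j ∈ P.nbrs i m, G i j else 0) =
      ∑ i, ∑ j, if P.graph.Adj i j ∧ P.Involved i m ∧ P.Involved j m then G i j else 0 := by
    intro G
    refine Finset.sum_congr rfl fun i _ => ?_
    by_cases hi : P.Involved i m
    · simp [hi, nbrs, Finset.sum_filter]
    · simp [hi]
  rw [key F, key fun i j => F j i, Finset.sum_comm]
  refine Finset.sum_congr rfl fun i _ => Finset.sum_congr rfl fun j _ => ?_
  exact if_congr (by rw [P.graph.adj_comm]; tauto) rfl rfl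

theorem localConstraint_eq_add (y y' : Aux N M) (i : Fin N) (m : Fin M) (xi : P.Local i) :
    P.localConstraint y' i m xi = P.localConstraint y i m xi +
      ∑ j ∈ P.nbrs i m, ((y' - y) (i, m) - (y' - y) (j, m)) := by
  have : ∑ j ∈ P.nbrs i m, ((y' - y) (i, m) - (y' - y) (j, m)) =
      ∑ j ∈ P.nbrs i m, (y' (i, m) - y' (j, m)) - ∑ j ∈ P.nbrs i m, (y (i, m) - y (j, m)) := by
    rw [← Finset.sum_sub_distrib]
    refine Finset.sum_congr rfl fun j _ => ?_
    simp only [PiLp.sub_apply]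
    ring
  rw [this, localConstraint, localConstraint]
  ring

theorem convexOn_localConstraint (y : Aux N M) (i : Fin N) (m : Fin M) :
    ConvexOn ℝ Set.univ (P.localConstraint y i m) :=
  ((innerₛₗ ℝ (P.a i m)).convexOn convex_univ |>.add_const _).add_const _

/-- Local feasibility implies the coupling constraints: in the sum over the involved agents the
auxiliary terms cancel by antisymmetry. -/
theorem feasible_of_localFeasible {y : Aux N M} {x : P.Primal}
    (h : ∀ i, P.LocalFeasible y i (x i)) : P.Feasible x := by
  classical
  intro m
  have h0 : ∑ i, (if P.Involved i m then
      ∑ j ∈ P.nbrs i m, (y (i, m) - y (j, m)) else 0) = 0 := by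
    have h1 := P.sum_nbrs_comm m fun i j => y (i, m) - y (j, m)
    have h2 : ∑ i, (if P.Involved i m then ∑ j ∈ P.nbrs i m, (y (j, m) - y (i, m)) else 0) =
        -∑ i, (if P.Involved i m then ∑ j ∈ P.nbrs i m, (y (i, m) - y (j, m)) else 0) := by
      rw [← Finset.sum_neg_distrib]
      refine Finset.sum_congr rfl fun i _ => ?_
      split_ifs
      · simp
      · simp
    linarith
  calc ∑ i, (inner ℝ (P.a i m) (x i) + P.b i m)
      = ∑ i, (inner ℝ (P.a i m) (x i) + P.b i m + if P.Involved i m then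
          ∑ j ∈ P.nbrs i m, (y (i, m) - y (j, m)) else 0) := by
        rw [Finset.sum_add_distrib (f := fun i => inner ℝ (P.a i m) (x i) + P.b i m), h0, add_zero]
    _ ≤ 0 := Finset.sum_nonpos fun i _ => by
        by_cases hi : P.Involved i m
        · have := h i m hi
          rw [localConstraint] at this
          rw [if_pos hi]
          linarith
        · have hi' := hi
          simp only [Involved, not_or, not_not] at hi'
          simp [hi, hi'.1, hi'.2]

/-- By consistency of the graph, every point that satisfies the coupling constraints is locally
feasible for suitable auxiliary variables: they solve, on the agents involved in each constraint,
the Laplace equation whose right-hand side is the local contribution recentred to have sum zero. -/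
theorem exists_localFeasible (hcons : ∀ m, P.Consistent m) {x : P.Primal} (hx : P.Feasible x) :
    ∃ y : Aux N M, ∀ i, P.LocalFeasible y i (x i) := by
  classical
  have hm : ∀ m, ∃ u : {i // P.Involved i m} → ℝ, ∀ i : {i // P.Involved i m},
      inner ℝ (P.a i m) (x i) + ((P.graph.induce {i | P.Involved i m}).lapMatrix ℝ).mulVec u i
        + P.b i m ≤ 0 := by
    intro m
    set s : {i // P.Involved i m} → ℝ := fun i => inner ℝ (P.a i m) (x i) + P.b i m with hs
    set S : ℝ := ∑ i, s i with hS
    have hS0 : S ≤ 0 := by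
      refine le_of_eq_of_le ?_ (hx m)
      rw [hS, hs, ← Finset.sum_subtype (Finset.univ.filter fun i => P.Involved i m) (by simp)
        fun i => inner ℝ (P.a i m) (x i) + P.b i m]
      refine Finset.sum_filter_of_ne fun i _ hi => ?_
      contrapose! hi
      simp only [Involved, not_or, not_not] at hi
      simp [hi.1, hi.2]
    have hsum : ∑ i, (S / Fintype.card {i // P.Involved i m} - s i) = 0 := by
      rw [Finset.sum_sub_distrib, ← hS, Finset.sum_const, Finset.card_univ, nsmul_eq_mul]
      rcases isEmpty_or_nonempty {i // P.Involved i m} with he | hne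
      · simp [hS]
      · rw [mul_div_cancel₀ _ (Nat.cast_ne_zero.2 Fintype.card_ne_zero), sub_self]
    obtain ⟨u, hu⟩ := (hcons m).exists_lapMatrix_mulVec_eq hsum
    refine ⟨u, fun i => ?_⟩
    have h1 : S / Fintype.card {i // P.Involved i m} ≤ 0 :=
      div_nonpos_of_nonpos_of_nonneg hS0 (Nat.cast_nonneg _)
    have h2 := congrFun hu i
    simp only [hs] at h2
    linarith
  choose u hu using hm
  refine ⟨WithLp.toLp 2 fun p => if h : P.Involved p.1 p.2 then u p.2 ⟨p.1, h⟩ else 0,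
    fun i m hi => ?_⟩
  have hmap : P.nbrs i m = ((P.graph.induce {i | P.Involved i m}).neighborFinset ⟨i, hi⟩).map
      (Function.Embedding.subtype _) := by
    ext j
    simp [mem_nbrs]
  have h := hu m ⟨i, hi⟩
  rw [SimpleGraph.lapMatrix_mulVec_apply] at h
  rw [localConstraint, hmap, Finset.sum_map]
  refine le_of_eq_of_le ?_ h
  congr 2
  rw [← SimpleGraph.card_neighborFinset_eq_degree, ← nsmul_eq_mul, ← Finset.sum_const,
    ← Finset.sum_sub_distrib]
  refine Finset.sum_congr rfl fun j _ => ?_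
  have hj : P.Involved (j : Fin N) m := j.2
  simp [hi, hj]

/-- A multiplier makes `localValue` a genuine lower bound of the cost, and not the junk value of an
infimum of an unbounded set: the Lagrangian does not exceed the cost of a feasible point. -/
theorem localValue_le {y : Aux N M} {i : Fin N} {ci : Fin M → ℝ}
    (hc : P.IsLagrangeMultiplier y i ci) {xi : P.Local i} (hx : P.LocalFeasible y i xi) :
    P.localValue y i ≤ P.cost i xi := by
  have h := hc.2.2.1 ⟨xi, rfl⟩
  have h1 : ∑ m, ci m * P.localConstraint y i m xi ≤ 0 := Finset.sum_nonpos fun m _ => by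
    by_cases hm : P.Involved i m
    · exact mul_nonpos_of_nonneg_of_nonpos (hc.1 m) (hx m hm)
    · rw [hc.2.1 m hm, zero_mul]
  simp only at h
  linarith

theorem nonempty_localFeasible (hslater : P.LocalSlater) (y : Aux N M) (i : Fin N) :
    (P.cost i '' {xi | P.LocalFeasible y i xi}).Nonempty := by
  obtain ⟨xi, hxi⟩ := hslater y i
  exact ⟨_, xi, fun m hm => (hxi m hm).le, rfl⟩

theorem IsLocalSolution.cost_eq {y : Aux N M} {i : Fin N} {ci : Fin M → ℝ}
    (hc : P.IsLagrangeMultiplier y i ci) {xi : P.Local i} (hx : P.IsLocalSolution y i xi) :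
    P.cost i xi = P.localValue y i := by
  refine le_antisymm (le_csInf ⟨_, xi, hx.1, rfl⟩ ?_) (localValue_le hc hx.1)
  rintro _ ⟨x', hx', rfl⟩
  exact hx.2 x' hx'

/-- Weak duality for shifted constraints: the multipliers at `y` bound the local value at `y'` from
below. -/
theorem localValue_add_le (hslater : P.LocalSlater) {y : Aux N M} {i : Fin N} {ci : Fin M → ℝ}
    (hc : P.IsLagrangeMultiplier y i ci) (y' : Aux N M) :
    P.localValue y i + ∑ m, ci m * ∑ j ∈ P.nbrs i m, ((y' - y) (i, m) - (y' - y) (j, m)) ≤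
      P.localValue y' i := by
  refine le_csInf (nonempty_localFeasible hslater y' i) ?_
  rintro _ ⟨xi, hxi, rfl⟩
  have h := hc.2.2.1 ⟨xi, rfl⟩
  have h1 : ∑ m, ci m * P.localConstraint y' i m xi ≤ 0 := Finset.sum_nonpos fun m _ => by
    by_cases hm : P.Involved i m
    · exact mul_nonpos_of_nonneg_of_nonpos (hc.1 m) (hxi m hm)
    · rw [hc.2.1 m hm, zero_mul]
  simp only [localConstraint_eq_add y y', mul_add, Finset.sum_add_distrib] at h1 h
  linarith

/-! ### The value function and its subgradients -/

open Classical in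
/-- The subgradient of `value` determined by multipliers `c` of the local problems. Up to the factor
`-k₀` it is the right-hand side of the update law. -/
noncomputable def valueSubgradient (P : CoupledProgram N M) (c : Fin N → Fin M → ℝ) : Aux N M :=
  WithLp.toLp 2 fun p => if P.Involved p.1 p.2 then
    ∑ j ∈ P.nbrs p.1 p.2, (c p.1 p.2 - c j p.2) else 0

theorem updateField_eq (k₀ : ℝ) (c : Aux N M → Fin N → Fin M → ℝ) :
    P.updateField k₀ c = fun y => -k₀ • P.valueSubgradient (c y) := by
  ext y p
  simp only [updateField, valueSubgradient, PiLp.smul_apply, smul_eq_mul, mul_ite, mul_zero]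

theorem inner_valueSubgradient {c : Fin N → Fin M → ℝ}
    (hc : ∀ i m, ¬ P.Involved i m → c i m = 0) (v : Aux N M) :
    inner ℝ (P.valueSubgradient c) v =
      ∑ i, ∑ m, c i m * ∑ j ∈ P.nbrs i m, (v (i, m) - v (j, m)) := by
  classical
  rw [PiLp.inner_apply, Fintype.sum_prod_type, Finset.sum_comm, Finset.sum_comm (γ := Fin N)]
  refine Finset.sum_congr rfl fun m _ => ?_
  have hl : ∀ i, inner ℝ (P.valueSubgradient c (i, m)) (v (i, m)) =
      (if P.Involved i m then ∑ _j ∈ P.nbrs i m, c i m * v (i, m) else 0) -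
        if P.Involved i m then ∑ j ∈ P.nbrs i m, c j m * v (i, m) else 0 := fun i => by
    by_cases hi : P.Involved i m
    · simp only [valueSubgradient, hi, if_true, ← Finset.sum_sub_distrib]
      simp only [RCLike.inner_apply, conj_trivial, Finset.mul_sum]
      exact Finset.sum_congr rfl fun j _ => by ring
    · simp [valueSubgradient, hi]
  have hr : ∀ i, c i m * ∑ j ∈ P.nbrs i m, (v (i, m) - v (j, m)) =
      (if P.Involved i m then ∑ _j ∈ P.nbrs i m, c i m * v (i, m) else 0) -
        if P.Involved i m then ∑ j ∈ P.nbrs i m, c i m * v (j, m) else 0 := fun i => by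
    by_cases hi : P.Involved i m
    · simp only [hi, if_true, ← Finset.sum_sub_distrib, Finset.mul_sum, mul_sub]
    · simp [hi, hc i m hi]
  rw [Finset.sum_congr rfl fun i _ => hl i, Finset.sum_congr rfl fun i _ => hr i,
    Finset.sum_sub_distrib, Finset.sum_sub_distrib]
  rw [sum_nbrs_comm m fun i j => c j m * v (i, m)]

/-- `valueSubgradient` is a subgradient of `value`, by weak duality for each local problem. -/
theorem value_add_inner_le (hslater : P.LocalSlater) {y : Aux N M} {c : Fin N → Fin M → ℝ}
    (hc : ∀ i, P.IsLagrangeMultiplier y i (c i)) (y' : Aux N M) :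
    P.value y + inner ℝ (P.valueSubgradient c) (y' - y) ≤ P.value y' := by
  rw [inner_valueSubgradient fun i m => (hc i).2.1 m, value, value, ← Finset.sum_add_distrib]
  exact Finset.sum_le_sum fun i _ => localValue_add_le hslater (hc i) y'

theorem value_le_totalCost {y : Aux N M} {c : Fin N → Fin M → ℝ}
    (hc : ∀ i, P.IsLagrangeMultiplier y i (c i)) {x : P.Primal}
    (hx : ∀ i, P.LocalFeasible y i (x i)) : P.value y ≤ P.totalCost x :=
  Finset.sum_le_sum fun i _ => localValue_le (hc i) (hx i)

theorem totalCost_eq_value {y : Aux N M} {c : Fin N → Fin M → ℝ}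
    (hc : ∀ i, P.IsLagrangeMultiplier y i (c i)) {x : P.Primal}
    (hx : ∀ i, P.IsLocalSolution y i (x i)) : P.totalCost x = P.value y :=
  Finset.sum_congr rfl fun i _ => (hx i).cost_eq (hc i)

/-- The optimal value of the coupled problem is a lower bound of `value`. -/
theorem IsOptimal.totalCost_le_value (hslater : P.LocalSlater) {xs : P.Primal}
    (hxs : P.IsOptimal xs) (y : Aux N M) : P.totalCost xs ≤ P.value y := by
  refine le_of_forall_pos_le_add fun ε hε => ?_
  have hδ : 0 < ε / (N + 1) := by positivity
  have hx : ∀ i, ∃ xi, P.LocalFeasible y i xi ∧ P.cost i xi < P.localValue y i + ε / (N + 1) := by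
    intro i
    obtain ⟨_, ⟨xi, hxi, rfl⟩, hlt⟩ := exists_lt_of_csInf_lt (nonempty_localFeasible hslater y i)
      (lt_add_of_pos_right (P.localValue y i) hδ)
    exact ⟨xi, hxi, hlt⟩
  choose x hxf hxc using hx
  calc P.totalCost xs ≤ P.totalCost x := hxs.2 x (feasible_of_localFeasible hxf)
    _ ≤ ∑ i, (P.localValue y i + ε / (N + 1)) := Finset.sum_le_sum fun i _ => (hxc i).le
    _ = P.value y + N * (ε / (N + 1)) := by simp [Finset.sum_add_distrib, value]
    _ ≤ P.value y + ε := by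
      -- Division by `N + 1` rather than `N` also covers `N = 0`.
      gcongr
      rw [mul_div_assoc', div_le_iff₀ (by positivity)]
      nlinarith

/-- The coupled problem and the minimization of `value` have the same optimal value. -/
theorem IsOptimal.exists_value_eq (hslater : P.LocalSlater) (hcons : ∀ m, P.Consistent m)
    {c : Aux N M → Fin N → Fin M → ℝ} (hc : ∀ y i, P.IsLagrangeMultiplier y i (c y i))
    {xs : P.Primal} (hxs : P.IsOptimal xs) : ∃ η, P.value η = P.totalCost xs := by
  obtain ⟨η, hη⟩ := exists_localFeasible hcons hxs.1
  exact ⟨η, le_antisymm (value_le_totalCost (hc η) hη) (hxs.totalCost_le_value hslater η)⟩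

/-- Local optimal values depend continuously on the auxiliary variables: each is convex, with the
subgradient determined by the multiplier of the single agent. -/
theorem continuous_localValue (hslater : P.LocalSlater) {c : Aux N M → Fin N → Fin M → ℝ}
    (hc : ∀ y i, P.IsLagrangeMultiplier y i (c y i)) (i : Fin N) :
    Continuous fun y => P.localValue y i := by
  classical
  refine (convexOn_of_subgradient
    (g := fun y => P.valueSubgradient (Pi.single i (c y i))) fun y y' => ?_).locallyLipschitz
    |>.continuous
  rw [inner_valueSubgradient, Finset.sum_eq_single i]
  · simpa using localValue_add_le hslater (hc y i) y'
  · intro j _ hj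
    simp [Pi.single_eq_of_ne hj]
  · simp
  · intro j m hj
    by_cases h : j = i
    · subst h
      simpa using (hc y j).2.1 m hj
    · simp [Pi.single_eq_of_ne h]

/-! ### Asymptotic optimality of the solutions of the local problems -/

theorem convexOn_totalCost (hconv : ∀ i, ConvexOn ℝ Set.univ (P.cost i)) :
    ConvexOn ℝ Set.univ P.totalCost :=
  ConvexOn.finset_sum _ fun i _ =>
    (hconv i).comp_linearMap (LinearMap.proj (R := ℝ) (φ := P.Local) i)

/-- The merit function of the coupled problem, regarded as a convex program with optimal value
`v`. -/
noncomputable def coupledMerit (P : CoupledProgram N M) (v : ℝ) : P.Primal → ℝ :=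
  programMerit P.totalCost (fun m x => ∑ i, (inner ℝ (P.a i m) (x i) + P.b i m)) v

theorem convexOn_coupledMerit (hconv : ∀ i, ConvexOn ℝ Set.univ (P.cost i)) (v : ℝ) :
    ConvexOn ℝ Set.univ (P.coupledMerit v) :=
  convexOn_programMerit (convexOn_totalCost hconv) fun m => ConvexOn.finset_sum _ fun i _ =>
    (((innerₛₗ ℝ (P.a i m)) ∘ₗ LinearMap.proj (R := ℝ) (φ := P.Local) i).convexOn
      convex_univ).add_const _

theorem IsOptimal.coupledMerit_eq_zero_iff {xs : P.Primal} (hxs : P.IsOptimal xs) {x : P.Primal} :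
    P.coupledMerit (P.totalCost xs) x = 0 ↔ P.IsOptimal x := by
  rw [coupledMerit, programMerit_eq_zero_iff]
  exact ⟨fun h => ⟨h.2, fun x' hx' => h.1.trans (hxs.2 x' hx')⟩, fun h => ⟨h.2 xs hxs.1, h.1⟩⟩

/-- If the auxiliary variables converge to a point where all local problems have unique solutions,
then the local solutions converge to the local solutions at the limit. -/
theorem tendsto_localSolution (hconv : ∀ i, ConvexOn ℝ Set.univ (P.cost i))
    (hslater : P.LocalSlater) {c : Aux N M → Fin N → Fin M → ℝ}
    (hc : ∀ y i, P.IsLagrangeMultiplier y i (c y i)) {y : ℝ → Aux N M} {η : Aux N M}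
    (hy : Tendsto y atTop (𝓝 η)) {i : Fin N} {x : ℝ → P.Local i}
    (hx : ∀ t, 0 ≤ t → P.IsLocalSolution (y t) i (x t)) {z : P.Local i}
    (hz : P.IsLocalSolution η i z) (huniq : ∀ z', P.IsLocalSolution η i z' → z' = z) :
    Tendsto x atTop (𝓝 z) := by
  classical
  set V : P.Local i → ℝ := programMerit (P.cost i)
    (fun m : {m // P.Involved i m} => P.localConstraint η i m) (P.localValue η i) with hVdef
  have hV : ConvexOn ℝ Set.univ V :=
    convexOn_programMerit (hconv i) fun m => convexOn_localConstraint η i m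
  have hV0 : ∀ z', V z' = 0 ↔ z' = z := fun z' => by
    rw [hVdef, programMerit_eq_zero_iff]
    constructor
    · intro h
      exact huniq z' ⟨fun m hm => h.2 ⟨m, hm⟩, fun x' hx' => h.1.trans (localValue_le (hc η i) hx')⟩
    · rintro rfl
      exact ⟨(hz.cost_eq (hc η i)).le, fun m => hz.1 m m.2⟩
  have hset : {z' | V z' = 0} = {z} := Set.ext hV0
  have hlim : Tendsto (fun t => V (x t)) atTop (𝓝 0) := by
    refine tendsto_programMerit (w := fun m t =>
      ∑ j ∈ P.nbrs i m, ((η - y t) (i, m.1) - (η - y t) (j, m.1))) ?_ ?_ ?_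
    · refine (((continuous_localValue hslater hc i).tendsto η).comp hy).congr' ?_
      filter_upwards [eventually_ge_atTop 0] with t ht
      exact ((hx t ht).cost_eq (hc (y t) i)).symm
    · intro m
      have hcont : Continuous fun y' : Aux N M =>
          ∑ j ∈ P.nbrs i m, ((η - y') (i, m.1) - (η - y') (j, m.1)) := by
        simp only [PiLp.sub_apply]
        fun_prop
      simpa [Function.comp_def] using (hcont.tendsto η).comp hy
    · intro m
      filter_upwards [eventually_ge_atTop 0] with t ht
      rw [localConstraint_eq_add (y t) η]
      linarith [(hx t ht).1 m m.2]
  obtain ⟨R, hR⟩ := hV.eventually_mem_closedBall_of_isBounded_zeros programMerit_nonneg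
    ((hV0 z).2 rfl) (hset ▸ Bornology.isBounded_singleton) hlim
  have hconvg := convergesToSet_zeros_of_isCompact hV.locallyLipschitz.continuous hlim
    (isCompact_closedBall z R) hR
  refine Metric.tendsto_nhds.2 fun ε hε => (hconvg ε hε).mono fun t ht => ?_
  obtain ⟨z', hz', hd⟩ := ht
  rwa [(hV0 z').1 hz'] at hd

end CoupledProgram

/-! ### Convergence of the distributed update law -/

theorem mainTheorem3 {N M : ℕ} (P : CoupledProgram N M)
    (hconv : ∀ i, ConvexOn ℝ Set.univ (P.cost i))
    (hopt : ∃ x, P.IsOptimal x)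
    (hslater : P.LocalSlater)
    (hcons : ∀ m, P.Consistent m)
    (k₀ : ℝ) (hk₀ : 0 < k₀)
    (c : CoupledProgram.Aux N M → Fin N → Fin M → ℝ)
    (hc : ∀ y i, P.IsLagrangeMultiplier y i (c y i))
    (y : ℝ → CoupledProgram.Aux N M)
    (hy : IsCaratheodorySolution (P.updateField k₀ c) y) :
    -- uniqueness
    (∀ z, IsCaratheodorySolution (P.updateField k₀ c) z → z 0 = y 0 → ∀ t, 0 ≤ t → z t = y t) ∧
    -- convergence to the set of optimal auxiliary variables
    ConvergesToSet y {η | ∀ η', P.value η ≤ P.value η'} ∧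
    ((∀ η i, ∃ xi, P.IsLocalSolution η i xi) →
      ConvergesToSet y {η | ∃ x, P.IsEquivOptimal x η}) ∧
    -- asymptotic optimality of the solutions of the local problems
    (∀ x : ℝ → P.Primal, (∀ t, 0 ≤ t → ∀ i, P.IsLocalSolution (y t) i (x t i)) →
      (∀ xs, P.IsOptimal xs → Tendsto (fun t => P.totalCost (x t)) atTop (𝓝 (P.totalCost xs))) ∧
      (∀ xs, MapClusterPt xs atTop x → P.IsOptimal xs) ∧
      ((Bornology.IsBounded {xs | P.IsOptimal xs} ∨
          ∃ T, Bornology.IsBounded (x '' Set.Ici T)) →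
        ConvergesToSet x {xs | P.IsOptimal xs}) ∧
      ((∀ η i, ∃! xi, P.IsLocalSolution η i xi) →
        ∃ xs, P.IsOptimal xs ∧ Tendsto x atTop (𝓝 xs))) ∧
    -- the coupling constraints hold at all times
    (∀ t, 0 ≤ t → ∀ x : P.Primal, (∀ i, P.LocalFeasible (y t) i (x i)) → P.Feasible x) := by
  obtain ⟨xo, hxo⟩ := hopt
  obtain ⟨η₀, hη₀⟩ := hxo.exists_value_eq hslater hcons hc
  have hg : ∀ y z : CoupledProgram.Aux N M,
      P.value y + inner ℝ (P.valueSubgradient (c y)) (z - y) ≤ P.value z :=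
    fun y z => CoupledProgram.value_add_inner_le hslater (hc y) z
  have hlow := hxo.totalCost_le_value hslater
  rw [CoupledProgram.updateField_eq] at hy ⊢
  obtain ⟨η, hη, hlim⟩ := subgradientFlow_tendsto hk₀ hg hy (z := η₀)
    fun y' => hη₀.trans_le (hlow y')
  have hηv : P.value η = P.totalCost xo := le_antisymm ((hη η₀).trans_eq hη₀) (hlow η)
  have hto : ∀ S : Set (CoupledProgram.Aux N M), η ∈ S → ConvergesToSet y S := fun S hS ε hε =>
    (Metric.tendsto_nhds.1 hlim ε hε).mono fun t ht => ⟨η, hS, ht⟩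
  refine ⟨fun z hz h0 t ht => subgradientFlow_unique hk₀ hg hy hz h0 ht, hto _ hη, fun hatt => ?_,
    fun x hx => ?_, fun t _ x hx => CoupledProgram.feasible_of_localFeasible hx⟩
  · choose xη hxη using hatt η
    refine hto _ ⟨xη, fun i => (hxη i).1, fun x' y' hx' => ?_⟩
    rw [CoupledProgram.totalCost_eq_value (hc η) hxη]
    exact (hη y').trans (CoupledProgram.value_le_totalCost (hc y') hx')
  · have hcost : Tendsto (fun t => P.totalCost (x t)) atTop (𝓝 (P.totalCost xo)) := by
      rw [← hηv]
      refine (((convexOn_of_subgradient hg).locallyLipschitz.continuous.tendsto η).comp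
        hlim).congr' ?_
      filter_upwards [eventually_ge_atTop 0] with t ht
      exact (CoupledProgram.totalCost_eq_value (hc (y t)) (hx t ht)).symm
    have hV := CoupledProgram.convexOn_coupledMerit hconv (P.totalCost xo)
    have hVc : Continuous (P.coupledMerit (P.totalCost xo)) := hV.locallyLipschitz.continuous
    have hVlim : Tendsto (fun t => P.coupledMerit (P.totalCost xo) (x t)) atTop (𝓝 0) := by
      refine tendsto_programMerit (w := fun _ _ => 0) hcost (fun _ => tendsto_const_nhds)
        fun m => ?_
      filter_upwards [eventually_ge_atTop 0] with t ht
      exact CoupledProgram.feasible_of_localFeasible (fun i => (hx t ht i).1) m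
    have hset : {xs | P.IsOptimal xs} = {xs | P.coupledMerit (P.totalCost xo) xs = 0} :=
      Set.ext fun xs => hxo.coupledMerit_eq_zero_iff.symm
    have hcl : ∀ xs, MapClusterPt xs atTop x → P.IsOptimal xs := fun xs h =>
      hxo.coupledMerit_eq_zero_iff.1 (h.eq_of_tendsto_comp hVc hVlim)
    refine ⟨fun xs hxs => ?_, hcl, fun hb => ?_, fun huniq => ?_⟩
    · rwa [le_antisymm (hxs.2 xo hxo.1) (hxo.2 xs hxs.1)]
    · rw [hset] at hb ⊢
      rcases hb with hb | ⟨T, hb⟩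
      · obtain ⟨R, hR⟩ := hV.eventually_mem_closedBall_of_isBounded_zeros programMerit_nonneg
          (hxo.coupledMerit_eq_zero_iff.2 hxo) hb hVlim
        exact convergesToSet_zeros_of_isCompact hVc hVlim (isCompact_closedBall xo R) hR
      · refine convergesToSet_zeros_of_isCompact hVc hVlim hb.isCompact_closure ?_
        filter_upwards [eventually_ge_atTop T] with t ht
        exact subset_closure ⟨t, ht, rfl⟩
    · choose xη hxη hxu using huniq η
      have hxt : Tendsto x atTop (𝓝 xη) := tendsto_pi_nhds.2 fun i =>
        CoupledProgram.tendsto_localSolution hconv hslater hc hlim (fun t ht => hx t ht i)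
          (hxη i) (hxu i)
      exact ⟨xη, hcl xη hxt.mapClusterPt, hxt⟩
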